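/- Let $p$ be a prime and let $G$ be a finite group. A finite group is called $p$-nilpotent if it has a normal subgroup of order prime to $p$ whose quotient is a $p$-group; a subgroup of $G$ is maximal $p$-nilpotent if it is maximal, with respect to inclusion, among the $p$-nilpotent subgroups of $G$. For a finite group $X$ let $O_{p'}(X)$ be the largest normal subgroup of $X$ of order prime to $p$, and let $Z_\infty(X)$ be the hypercentre of $X$, that is, the last term of its upper central series. Let $Z_{p\mathcal N}(G)$ be the product of all normal subgroups $N$ of $G$ such that, for every chief factor $H/K$ of $G$ with $H\le N$ and order divisible by $p$, the semidirect product $(H/K)\rtimes (G/C_G(H/K))$, formed with respect to the conjugation action, is nilpotent. Let $D$ be the intersection of all maximal $p$-nilpotent subgroups of $G$. Then $D$ is the largest normal subgroup of $G$ satisfying $$O_{p'}(D)=O_{p'}(G)\quad\text{and}\quad D/O_{p'}(G)\le Z_\infty\bigl(G/O_{p'}(G)\bigr);$$ that is, $D$ is a normal subgroup of $G$ with these two properties, and every normal subgroup of $G$ with these two properties is contained in $D$. Moreover, $D=Z_{p\mathcal N}(G)$. -/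

import Mathlib

universe u

namespace PNilp

/-- A finite group `G` is `p`-nilpotent if it has a normal `p`-complement: a normal subgroup of
order prime to `p` whose quotient is a `p`-group. -/
def IsPNilpotent (p : ℕ) (G : Type u) [Group G] : Prop :=
  ∃ (N : Subgroup G) (_ : N.Normal), ¬ p ∣ Nat.card N ∧ IsPGroup p (G ⧸ N)

/-- `O_{p'}(G)`: the subgroup generated by all normal `p'`-subgroups of the finite group `G`
(it is the largest normal `p'`-subgroup). -/
def pPrimeCore (p : ℕ) (G : Type u) [Group G] : Subgroup G :=
  sSup {N : Subgroup G | N.Normal ∧ ¬ p ∣ Nat.card N}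

instance pPrimeCore_normal (p : ℕ) (G : Type u) [Group G] : (pPrimeCore p G).Normal :=
  Subgroup.sSup_normal _ fun _ h => h.1

/-- The hypercentre `Z_∞(G)` of a finite group: the union of the upper central series. -/
def hypercentre (G : Type u) [Group G] : Subgroup G :=
  ⨆ n : ℕ, Subgroup.upperCentralSeries G n

/-- The intersection of all maximal `p`-nilpotent subgroups of `G`. -/
def intMaxPNilpotent (p : ℕ) (G : Type u) [Group G] : Subgroup G :=
  sInf {U : Subgroup G | Maximal (fun V : Subgroup G => IsPNilpotent p V) U}

section ChiefFactors

variable {G : Type u} [Group G]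

/-- `H/K` is a chief factor of `G`: `K < H` are normal in `G` and no normal subgroup of `G` lies
strictly between them. -/
def IsChiefFactor (K H : Subgroup G) : Prop :=
  K.Normal ∧ H.Normal ∧ K < H ∧ ∀ L : Subgroup G, L.Normal → K ≤ L → L ≤ H → L = K ∨ L = H

/-- For `K ≤ H`, the factor `H/K`, as a subgroup of `G ⧸ K`. -/
abbrev factor (K H : Subgroup G) [K.Normal] : Subgroup (G ⧸ K) :=
  H.map (QuotientGroup.mk' K)

instance factor_normal (K H : Subgroup G) [K.Normal] [hH : H.Normal] : (factor K H).Normal :=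
  hH.map _ (QuotientGroup.mk'_surjective K)

/-- The action of `G` on `H/K` by conjugation. Its kernel is `C_G(H/K)`. -/
def factorConj (K H : Subgroup G) [K.Normal] [H.Normal] : G →* MulAut (factor K H) :=
  (MulAut.conjNormal (H := factor K H)).comp (QuotientGroup.mk' K)

/-- The semidirect product `(H/K) ⋊ (G/C_G(H/K))` with respect to the conjugation action. -/
abbrev FactorSemidirect (K H : Subgroup G) [K.Normal] [H.Normal] : Type u :=
  factor K H ⋊[QuotientGroup.kerLift (factorConj K H)] (G ⧸ (factorConj K H).ker)

/-- `N` is `πF`-hypercentral in `G`, for a set `π` of primes and a class `F` of groups: every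
chief factor `H/K` of `G` below `N` whose order is divisible by some prime in `π` is `F`-central,
i.e. `(H/K) ⋊ (G/C_G(H/K))` belongs to `F`. -/
def IsHypercentral (π : Set ℕ) (F : ∀ (X : Type u) [Group X], Prop) (N : Subgroup G) : Prop :=
  ∀ (K H : Subgroup G) [K.Normal] [H.Normal], IsChiefFactor K H → H ≤ N →
    (∃ q ∈ π, q ∣ Nat.card (factor K H)) → F (FactorSemidirect K H)

end ChiefFactors

/-- `Z_{πF}(G)`: the product of all normal `πF`-hypercentral subgroups of `G`. -/
def classHypercentre (π : Set ℕ) (F : ∀ (X : Type u) [Group X], Prop) (G : Type u) [Group G] :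
    Subgroup G :=
  sSup {N : Subgroup G | N.Normal ∧ IsHypercentral π F N}

/-- `Z_{pN}(G)`: the case where `π = {p}` and `F` is the class of all nilpotent groups. -/
def pNilpotentHypercentre (p : ℕ) (G : Type u) [Group G] : Subgroup G :=
  classHypercentre {p} (fun (X : Type u) [Group X] => Group.IsNilpotent X) G

end PNilp

/-!
# The intersection of the maximal `p`-nilpotent subgroups

Write `O` for `O_{p'}(G)` and `D` for the intersection of the maximal `p`-nilpotent subgroups. The
argument runs in a circle through three properties of a normal subgroup `N` of `G`.

* If `N O / O` lies in the hypercentre of `G / O`, then `N` is hypercentral in the sense of chief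
  factors (`isHypercentral_of_map_le_hypercentre`): a chief factor `H / K` below `N` of order
  divisible by `p` satisfies `H ⊓ O ≤ K`, and climbing the upper central series of `G / O` shows
  that it is central, whence `(H / K) ⋊ (G / C_G(H / K))` is abelian.
* If `N` is hypercentral in that sense, then `N ≤ D`. Nilpotency of the semidirect product forces
  the chief factor to be central (`factor_le_center_of_isNilpotent`). Extensions of `p`-nilpotent
  groups by `p'`-kernels or by central kernels are `p`-nilpotent, the latter by Burnside's transfer
  theorem (`IsPNilpotent.of_ker_le_center`). So `U N` is `p`-nilpotent whenever `U` is
  (`IsHypercentral.isPNilpotent_sup`), and `U` contains `N` if it is maximal `p`-nilpotent.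
* `D O / O` lies in the hypercentre of `G / O` (`map_intMaxPNilpotent_le_hypercentre`). Every
  `p'`-element of `G` lies in a maximal `p`-nilpotent subgroup, together with `D`, and therefore
  centralizes `D` modulo `O` (`commutator_mem_pPrimeCore`). Hence `G` acts on the `p`-group
  `D O / O` as a `p`-group, and counting fixed points modulo the hypercentre concludes
  (`le_hypercentre_of_isPGroup`).

The first two give maximality of `D`, and with the third they identify `D` with the product of all
hypercentral normal subgroups. They also give `O ≤ D`, and since `D` is `p`-nilpotent this yields
`O_{p'}(D) = O`.
-/

namespace PNilp

open scoped commutatorElement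

/-! ### Subgroups of order prime to `p` -/

section PPrime

variable {p : ℕ} [hp : Fact p.Prime] {X Y : Type u} [Group X] [Group Y] [Finite X] [Finite Y]

/-- By Cauchy's theorem, a subgroup has order prime to `p` iff it has no element of order `p`. -/
lemma not_dvd_card_iff {N : Subgroup X} : ¬ p ∣ Nat.card N ↔ ∀ x ∈ N, orderOf x ≠ p := by
  constructor
  · intro h x hx hxp
    exact h (hxp ▸ Subgroup.orderOf_dvd_natCard N hx)
  · intro h hd
    obtain ⟨x, hx⟩ := exists_prime_orderOf_dvd_card' p hd
    exact h x x.2 (by rw [Subgroup.orderOf_coe, hx])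

lemma not_dvd_card_comap (f : X →* Y) {M : Subgroup Y} (hM : ¬ p ∣ Nat.card M)
    (hf : ¬ p ∣ Nat.card f.ker) : ¬ p ∣ Nat.card (M.comap f) := by
  rw [not_dvd_card_iff] at hM hf ⊢
  intro x hx hxp
  rcases (Nat.dvd_prime hp.out).mp (hxp ▸ orderOf_map_dvd f x) with h | h
  · exact hf x (orderOf_eq_one_iff.mp h) hxp
  · exact hM _ hx h

omit hp [Finite X] [Finite Y] in
lemma not_dvd_card_map (f : X →* Y) {N : Subgroup X} (hN : ¬ p ∣ Nat.card N) :
    ¬ p ∣ Nat.card (N.map f) :=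
  fun h => hN (h.trans (Subgroup.card_dvd_of_surjective _ (f.subgroupMap_surjective N)))

lemma not_dvd_card_sup {M N : Subgroup X} [M.Normal] (hM : ¬ p ∣ Nat.card M)
    (hN : ¬ p ∣ Nat.card N) : ¬ p ∣ Nat.card (M ⊔ N : Subgroup X) := by
  rw [← QuotientGroup.comap_map_mk']
  exact not_dvd_card_comap _ (not_dvd_card_map _ hN) (by rwa [QuotientGroup.ker_mk'])

omit hp [Finite X] in
lemma le_pPrimeCore {N : Subgroup X} (h : N.Normal) (hN : ¬ p ∣ Nat.card N) :
    N ≤ pPrimeCore p X :=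
  le_sSup ⟨h, hN⟩

lemma not_dvd_card_pPrimeCore : ¬ p ∣ Nat.card (pPrimeCore p X) := by
  obtain ⟨M, ⟨hM, hMp⟩, hmax⟩ := (Set.toFinite
    {N : Subgroup X | N.Normal ∧ ¬ p ∣ Nat.card N}).exists_maximal
    ⟨⊥, inferInstance, by simpa using hp.out.ne_one⟩
  have h : pPrimeCore p X = M := by
    refine le_antisymm (sSup_le fun N hN => ?_) (le_pPrimeCore hM hMp)
    have := hN.1
    exact le_sup_right.trans
      (hmax ⟨Subgroup.sup_normal M N, not_dvd_card_sup hMp hN.2⟩ le_sup_left)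
  rwa [h]

omit [Finite Y] in
lemma map_pPrimeCore_le {f : X →* Y} (hf : Function.Surjective f) :
    (pPrimeCore p X).map f ≤ pPrimeCore p Y :=
  le_pPrimeCore ((pPrimeCore_normal p X).map f hf) (not_dvd_card_map f not_dvd_card_pPrimeCore)

instance pPrimeCore_characteristic : (pPrimeCore p X).Characteristic :=
  Subgroup.characteristic_iff_map_le.mpr fun φ => map_pPrimeCore_le φ.surjective

lemma map_subtype_pPrimeCore_le (N : Subgroup X) [N.Normal] :
    (pPrimeCore p N).map N.subtype ≤ pPrimeCore p X :=
  le_pPrimeCore inferInstance (not_dvd_card_map _ not_dvd_card_pPrimeCore)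

lemma exists_pow_not_dvd_orderOf (x : X) : ∃ k, ¬ p ∣ orderOf (x ^ p ^ k) := by
  obtain ⟨k, m, hm, h⟩ :=
    Nat.exists_eq_pow_mul_and_not_dvd (orderOf_pos x).ne' p hp.out.ne_one
  refine ⟨k, ?_⟩
  rwa [orderOf_pow_of_dvd (pow_ne_zero _ hp.out.ne_zero) (h ▸ dvd_mul_right _ _), h,
    Nat.mul_div_cancel_left _ (pow_pos hp.out.pos k)]

omit [Finite X] in
lemma mem_of_pow_mem {H : Subgroup X} {x : X} {k : ℕ} (hx : ¬ p ∣ orderOf x)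
    (h : x ^ p ^ k ∈ H) : x ∈ H := by
  have hc : (p ^ k).gcd (orderOf x) = 1 :=
    Nat.Coprime.pow_left k ((Nat.Prime.coprime_iff_not_dvd hp.out).mpr hx)
  exact (Subgroup.zpowers_le.mpr h) (mem_zpowers_pow_iff.mpr hc)

/-! ### `p`-nilpotent groups -/

/-- In a finite `p`-nilpotent group the normal `p`-complement is `O_{p'}`. -/
lemma isPNilpotent_iff : IsPNilpotent p X ↔ ∀ x : X, ∃ k, x ^ p ^ k ∈ pPrimeCore p X := by
  constructor
  · rintro ⟨N, hN, hNp, hq⟩ x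
    obtain ⟨k, hk⟩ := hq (x : X ⧸ N)
    exact ⟨k, le_pPrimeCore hN hNp ((QuotientGroup.eq_one_iff _).mp hk)⟩
  · intro h
    refine ⟨_, pPrimeCore_normal p X, not_dvd_card_pPrimeCore, fun y => ?_⟩
    obtain ⟨x, rfl⟩ := QuotientGroup.mk_surjective y
    exact (h x).imp fun k hk => (QuotientGroup.eq_one_iff _).mpr hk

lemma IsPNilpotent.mem_pPrimeCore (h : IsPNilpotent p X) {x : X} (hx : ¬ p ∣ orderOf x) :
    x ∈ pPrimeCore p X :=
  have ⟨_, hk⟩ := isPNilpotent_iff.mp h x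
  mem_of_pow_mem hx hk

lemma IsPNilpotent.of_surjective (h : IsPNilpotent p X) {f : X →* Y}
    (hf : Function.Surjective f) : IsPNilpotent p Y := by
  rw [isPNilpotent_iff] at h ⊢
  intro y
  obtain ⟨x, rfl⟩ := hf y
  obtain ⟨k, hk⟩ := h x
  exact ⟨k, map_pPrimeCore_le hf ⟨_, hk, map_pow f x _⟩⟩

lemma IsPNilpotent.of_not_dvd_card_ker (h : IsPNilpotent p Y) (f : X →* Y)
    (hf : ¬ p ∣ Nat.card f.ker) : IsPNilpotent p X := by
  rw [isPNilpotent_iff] at h ⊢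
  intro x
  obtain ⟨k, hk⟩ := h (f x)
  exact ⟨k, le_pPrimeCore ((pPrimeCore_normal p Y).comap f)
    (not_dvd_card_comap f not_dvd_card_pPrimeCore hf) (by simpa using hk)⟩

lemma IsPNilpotent.of_injective (h : IsPNilpotent p Y) {f : X →* Y}
    (hf : Function.Injective f) : IsPNilpotent p X :=
  h.of_not_dvd_card_ker f (by
    simpa [(MonoidHom.ker_eq_bot_iff f).mpr hf] using hp.out.ne_one)

lemma IsPNilpotent.of_le {U V : Subgroup X} (h : IsPNilpotent p V) (hUV : U ≤ V) :
    IsPNilpotent p U :=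
  h.of_injective (Subgroup.inclusion_injective hUV)

/-- A central extension of a `p`-nilpotent group is `p`-nilpotent. The preimage `N` of the normal
`p`-complement has central Sylow `p`-subgroups, so Burnside's transfer theorem provides a normal
`p`-complement of `N`; it lies in the characteristic subgroup `O_{p'}(N)`. -/
lemma IsPNilpotent.of_ker_le_center (h : IsPNilpotent p Y) (f : X →* Y)
    (hf : f.ker ≤ Subgroup.center X) : IsPNilpotent p X := by
  have hN : ((pPrimeCore p Y).comap f).Normal := (pPrimeCore_normal p Y).comap f
  set N : Subgroup X := (pPrimeCore p Y).comap f with hNdef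
  obtain ⟨P⟩ : Nonempty (Sylow p N) := inferInstance
  have hP : ∀ y ∈ P, (y : X) ∈ Subgroup.center X := by
    intro y hy
    apply hf
    obtain ⟨k, hk⟩ := P.isPGroup' ⟨y, hy⟩
    have hk' : (y : X) ^ p ^ k = 1 := by
      simpa using congrArg (fun z : P => ((z : N) : X)) hk
    have hfy : ¬ p ∣ orderOf (f y) := fun hd =>
      not_dvd_card_pPrimeCore (hd.trans (Subgroup.orderOf_dvd_natCard (pPrimeCore p Y) y.2))
    have : f y ∈ (⊥ : Subgroup Y) := mem_of_pow_mem (k := k) hfy (by rw [← map_pow, hk']; simp)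
    simpa using this
  have hPc : Subgroup.normalizer (P : Set N) ≤ Subgroup.centralizer (P : Set N) := by
    intro x _
    rw [Subgroup.mem_centralizer_iff]
    intro y hy
    exact Subtype.ext (Subgroup.mem_center_iff.mp (hP y hy) x).symm
  rw [isPNilpotent_iff] at h ⊢
  intro x
  obtain ⟨k, hk⟩ := h (f x)
  have hxN : x ^ p ^ k ∈ N := by simpa [hNdef] using hk
  obtain ⟨j, hj⟩ := P.isPGroup' (MonoidHom.transferSylow P hPc ⟨_, hxN⟩)
  have hT := le_pPrimeCore (MonoidHom.normal_ker _) (MonoidHom.not_dvd_card_ker_transferSylow P hPc)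
  refine ⟨k + j, map_subtype_pPrimeCore_le N ⟨⟨_, hxN⟩ ^ p ^ j, hT ?_, ?_⟩⟩
  · rw [MonoidHom.mem_ker, map_pow]
    exact hj
  · simp [pow_add, pow_mul]

lemma IsPNilpotent.of_map {f : X →* Y} {S : Subgroup X} (h : IsPNilpotent p (S.map f))
    (hf : ¬ p ∣ Nat.card f.ker ∨ f.ker ≤ Subgroup.center X) : IsPNilpotent p S := by
  have hker : ∀ x ∈ (f.subgroupMap S).ker, (x : X) ∈ f.ker :=
    fun x hx => congrArg Subtype.val (MonoidHom.mem_ker.mp hx)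
  rcases hf with hf | hf
  · refine h.of_not_dvd_card_ker (f.subgroupMap S) ?_
    rw [not_dvd_card_iff] at hf ⊢
    intro x hx
    rw [← Subgroup.orderOf_coe]
    exact hf x (hker x hx)
  · refine h.of_ker_le_center (f.subgroupMap S) fun x hx => ?_
    rw [Subgroup.mem_center_iff]
    exact fun y => Subtype.ext (Subgroup.mem_center_iff.mp (hf (hker x hx)) y)

end PPrime

section Central

variable {G : Type u} [Group G]

/-! ### Central chief factors -/

lemma le_upperCentralSeriesStep (K : Subgroup G) [hK : K.Normal] :
    K ≤ Subgroup.upperCentralSeriesStep K := fun x hx y => by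
  have := K.mul_mem hx (hK.conj_mem _ (K.inv_mem hx) y)
  simpa [commutatorElement_def, mul_assoc] using this

/-- A nontrivial normal subgroup of a nilpotent group meets the centre nontrivially. -/
lemma exists_mem_center_of_isNilpotent [Group.IsNilpotent G] {M : Subgroup G} (hM : M.Normal)
    (h : M ≠ ⊥) : ∃ x ∈ M, x ≠ 1 ∧ x ∈ Subgroup.center G := by
  classical
  obtain ⟨c, hc⟩ := Group.IsNilpotent.nilpotent G
  have hex : ∃ n, M ⊓ Subgroup.upperCentralSeries G n ≠ ⊥ := ⟨c, by rwa [hc, inf_top_eq]⟩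
  obtain ⟨n, hn, hmin⟩ : ∃ n, M ⊓ Subgroup.upperCentralSeries G n ≠ ⊥ ∧
      ∀ m < n, M ⊓ Subgroup.upperCentralSeries G m = ⊥ :=
    ⟨Nat.find hex, Nat.find_spec hex, fun m hm => not_not.mp (Nat.find_min hex hm)⟩
  cases n with
  | zero => simp at hn
  | succ m =>
    obtain ⟨⟨x, hxM, hxZ⟩, hx⟩ := Subgroup.ne_bot_iff_exists_ne_one.mp hn
    have hx1 : x ≠ 1 := fun h => hx (Subtype.ext h)
    refine ⟨x, hxM, hx1, Subgroup.mem_center_iff.mpr fun y => ?_⟩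
    have hy : ⁅x, y⁆ ∈ M ⊓ Subgroup.upperCentralSeries G m := by
      exact ⟨le_upperCentralSeriesStep M hxM y,
        Subgroup.mem_upperCentralSeries_succ_iff.mp hxZ y⟩
    rw [hmin m m.lt_succ_self, Subgroup.mem_bot, commutatorElement_eq_one_iff_mul_comm] at hy
    exact hy.symm

lemma factor_le_center_iff {K H : Subgroup G} [K.Normal] :
    factor K H ≤ Subgroup.center (G ⧸ K) ↔ H ≤ Subgroup.upperCentralSeriesStep K := by
  rw [Subgroup.upperCentralSeriesStep_eq_comap_center, Subgroup.map_le_iff_le_comap]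

lemma coe_factorConj_apply (K H : Subgroup G) [K.Normal] [H.Normal] (g : G) (a : factor K H) :
    (factorConj K H g a : G ⧸ K) = g * a * (g : G ⧸ K)⁻¹ :=
  MulAut.conjNormal_apply _ _

/-- A chief factor `H/K` is central as soon as `(H/K) ⋊ (G/C_G(H/K))` is nilpotent: the centre of
this group meets `H/K` nontrivially, and the fixed points of `G` in `H/K` form `1` or `H/K`. -/
lemma factor_le_center_of_isNilpotent {K H : Subgroup G} [K.Normal] [H.Normal]
    (hc : IsChiefFactor K H) (hnil : Group.IsNilpotent (FactorSemidirect K H)) :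
    factor K H ≤ Subgroup.center (G ⧸ K) := by
  have hne : (SemidirectProduct.inl : factor K H →* FactorSemidirect K H).range ≠ ⊥ := by
    intro hbot
    refine hc.2.2.1.not_ge fun h hh => ?_
    have h1 : (⟨h, h, hh, rfl⟩ : factor K H) = 1 :=
      SemidirectProduct.inl_injective (φ := QuotientGroup.kerLift (factorConj K H))
        ((Subgroup.mem_bot.mp (hbot ▸ ⟨_, rfl⟩)).trans (map_one _).symm)
    exact (QuotientGroup.eq_one_iff h).mp (congrArg Subtype.val h1)
  obtain ⟨_, ⟨a, rfl⟩, ha1, ha⟩ := exists_mem_center_of_isNilpotent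
    (by rw [SemidirectProduct.range_inl_eq_ker_rightHom]; infer_instance) hne
  have hfix : ∀ g : G, factorConj K H g a = a := by
    intro g
    apply SemidirectProduct.inl_injective (φ := QuotientGroup.kerLift (factorConj K H))
    have h1 := SemidirectProduct.inl_aut (φ := QuotientGroup.kerLift (factorConj K H))
      (g : G ⧸ (factorConj K H).ker) a
    rw [QuotientGroup.kerLift_mk] at h1
    rw [h1, Subgroup.mem_center_iff.mp ha, mul_assoc, ← map_mul, mul_inv_cancel, map_one, mul_one]
  obtain ⟨_, h, hh, rfl⟩ := a
  have hstep : h ∈ Subgroup.upperCentralSeriesStep K := by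
    rw [Subgroup.upperCentralSeriesStep_eq_comap_center, Subgroup.mem_comap,
      Subgroup.mem_center_iff]
    intro y
    obtain ⟨g, rfl⟩ := QuotientGroup.mk_surjective y
    have := congrArg Subtype.val (hfix g)
    rw [coe_factorConj_apply] at this
    exact mul_inv_eq_iff_eq_mul.mp this
  rcases hc.2.2.2 (H ⊓ Subgroup.upperCentralSeriesStep K)
    (by rw [Subgroup.upperCentralSeriesStep_eq_comap_center]; infer_instance)
    (le_inf hc.2.2.1.le (le_upperCentralSeriesStep K)) inf_le_left with hL | hL
  · have hK : h ∈ K := hL ▸ ⟨hh, hstep⟩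
    refine (ha1 ?_).elim
    rw [← map_one SemidirectProduct.inl]
    exact congrArg _ (Subtype.ext ((QuotientGroup.eq_one_iff h).mpr hK))
  · exact factor_le_center_iff.mpr (inf_eq_left.mp hL)

lemma isNilpotent_factorSemidirect {K H : Subgroup G} [K.Normal] [H.Normal]
    (h : factor K H ≤ Subgroup.center (G ⧸ K)) : Group.IsNilpotent (FactorSemidirect K H) := by
  have hker : (factorConj K H).ker = ⊤ := by
    refine (Subgroup.eq_top_iff' _).mpr fun g => MulEquiv.ext fun a => Subtype.ext ?_
    rw [coe_factorConj_apply, Subgroup.mem_center_iff.mp (h a.2)]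
    simp
  have : Subsingleton (G ⧸ (factorConj K H).ker) := by
    rw [hker]; exact QuotientGroup.subsingleton_quotient_top
  have hcomm : ∀ x y : FactorSemidirect K H, x * y = y * x := by
    intro x y
    ext
    · have hx : x.right = 1 := Subsingleton.elim _ _
      have hy : y.right = 1 := Subsingleton.elim _ _
      simp only [SemidirectProduct.mul_left, hx, hy, map_one, MulAut.one_apply]
      exact congrArg Subtype.val (Subtype.ext (Subgroup.mem_center_iff.mp (h y.left.2) x.left) :
        x.left * y.left = y.left * x.left)
    · exact Subsingleton.elim _ _
  refine ⟨1, ?_⟩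
  rw [Subgroup.upperCentralSeries_one]
  exact (Subgroup.eq_top_iff' _).mpr fun x => Subgroup.mem_center_iff.mpr fun y => hcomm y x

/-! ### The hypercentre -/

lemma mem_hypercentre {x : G} :
    x ∈ hypercentre G ↔ ∃ n, x ∈ Subgroup.upperCentralSeries G n :=
  Subgroup.mem_iSup_of_directed (Subgroup.upperCentralSeries_mono G).directed_le

instance hypercentre_normal : (hypercentre G).Normal :=
  ⟨fun x hx g => by
    obtain ⟨n, hn⟩ := mem_hypercentre.mp hx
    exact mem_hypercentre.mpr ⟨n, Subgroup.Normal.conj_mem inferInstance x hn g⟩⟩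

lemma exists_upperCentralSeries_eq_hypercentre [Finite G] :
    ∃ n, Subgroup.upperCentralSeries G n = hypercentre G := by
  obtain ⟨n, hn⟩ := WellFoundedGT.monotone_chain_condition
    ⟨_, Subgroup.upperCentralSeries_mono G⟩
  refine ⟨n, le_antisymm (le_iSup _ n) (iSup_le fun m => ?_)⟩
  rcases le_total n m with h | h
  · exact (hn m h).ge
  · exact Subgroup.upperCentralSeries_mono G h

lemma upperCentralSeriesStep_hypercentre_le [Finite G] :
    Subgroup.upperCentralSeriesStep (hypercentre G) ≤ hypercentre G := by
  obtain ⟨n, hn⟩ := exists_upperCentralSeries_eq_hypercentre (G := G)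
  intro x hx
  refine mem_hypercentre.mpr ⟨n + 1, Subgroup.mem_upperCentralSeries_succ_iff.mpr fun y => ?_⟩
  rw [hn]
  exact hx y

variable {p : ℕ} [hp : Fact p.Prime]

/-- If some `p`-power of each element of `G` centralizes the nontrivial normal `p`-subgroup `D`,
then `G` acts on `D` as a `p`-group, and so it has a nontrivial fixed point. -/
lemma exists_mem_center_of_isPGroup [Finite G] {D : Subgroup G} [D.Normal] (hD : IsPGroup p D)
    (hne : D ≠ ⊥) (h : ∀ g : G, ∃ k, ∀ d ∈ D, g ^ p ^ k * d = d * g ^ p ^ k) :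
    ∃ d ∈ D, d ≠ 1 ∧ d ∈ Subgroup.center G := by
  have hR : IsPGroup p (MulAut.conjNormal : G →* MulAut D).range := by
    rintro ⟨_, g, rfl⟩
    obtain ⟨k, hk⟩ := h g
    refine ⟨k, Subtype.ext ?_⟩
    rw [Subgroup.coe_pow, ← map_pow]
    refine MulEquiv.ext fun d => Subtype.ext ?_
    rw [MulAut.conjNormal_apply, hk d d.2]
    simp
  have hcard : p ∣ Nat.card D :=
    hD.card_eq_or_dvd.resolve_left (mt Subgroup.card_eq_one.mp hne)
  obtain ⟨d, hd, hd1⟩ := hR.exists_fixed_point_of_prime_dvd_card_of_fixed_point D hcard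
    (a := 1) (fun r => map_one (r : MulAut D))
  refine ⟨d, d.2, fun h1 => hd1 (Subtype.ext h1.symm), Subgroup.mem_center_iff.mpr fun g => ?_⟩
  have := congrArg Subtype.val (hd ⟨_, g, rfl⟩)
  exact mul_inv_eq_iff_eq_mul.mp ((MulAut.conjNormal_apply g d).symm.trans this)

lemma le_hypercentre_of_isPGroup [Finite G] {D : Subgroup G} [hDn : D.Normal]
    (hD : IsPGroup p D) (h : ∀ g : G, ∃ k, ∀ d ∈ D, g ^ p ^ k * d = d * g ^ p ^ k) :
    D ≤ hypercentre G := by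
  have hn : (D.map (QuotientGroup.mk' (hypercentre G))).Normal :=
    hDn.map _ (QuotientGroup.mk'_surjective _)
  by_contra hle
  obtain ⟨_, ⟨d, hd, rfl⟩, hd1, hdc⟩ := exists_mem_center_of_isPGroup
    (hD.map (QuotientGroup.mk' (hypercentre G)))
    (by rwa [Ne, Subgroup.map_eq_bot_iff, QuotientGroup.ker_mk']) (by
      intro y
      obtain ⟨g, rfl⟩ := QuotientGroup.mk_surjective y
      obtain ⟨k, hk⟩ := h g
      refine ⟨k, ?_⟩
      rintro _ ⟨d, hd, rfl⟩
      exact congrArg (QuotientGroup.mk' (hypercentre G)) (hk d hd))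
  refine hd1 ((QuotientGroup.eq_one_iff d).mpr (upperCentralSeriesStep_hypercentre_le ?_))
  rw [Subgroup.upperCentralSeriesStep_eq_comap_center]
  exact hdc

/-! ### Hypercentral normal subgroups -/

/-- If `N O_{p'}(G) / O_{p'}(G)` is hypercentral, then every chief factor below `N` of order
divisible by `p` is central. -/
lemma isHypercentral_of_map_le_hypercentre [Finite G] {N : Subgroup G}
    (h : N.map (QuotientGroup.mk' (pPrimeCore p G)) ≤ hypercentre (G ⧸ pPrimeCore p G)) :
    IsHypercentral {p} (fun (X : Type u) [Group X] => Group.IsNilpotent X) N := by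
  intro K H hK hH hc hHN ⟨q, hq, hqd⟩
  obtain rfl : q = p := hq
  refine isNilpotent_factorSemidirect (factor_le_center_iff.mpr ?_)
  by_contra hcen
  have key : ∀ n, H ⊓ (Subgroup.upperCentralSeries (G ⧸ pPrimeCore q G) n).comap
      (QuotientGroup.mk' (pPrimeCore q G)) ≤ K := by
    intro n
    induction n with
    | zero =>
      rw [Subgroup.upperCentralSeries_zero, MonoidHom.comap_bot, QuotientGroup.ker_mk']
      rcases hc.2.2.2 (H ⊓ pPrimeCore q G ⊔ K) inferInstance le_sup_right
        (sup_le inf_le_left hc.2.2.1.le) with h1 | h1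
      · exact sup_eq_right.mp h1
      · -- `H / K` would be an image of the `p'`-group `H ⊓ O_{p'}(G)`.
        have h2 : factor K H = (H ⊓ pPrimeCore q G).map (QuotientGroup.mk' K) := by
          conv_lhs => rw [← h1]
          rw [factor, Subgroup.map_sup, QuotientGroup.map_mk'_self, sup_bot_eq]
        rw [h2] at hqd
        refine (not_dvd_card_map _ ?_ hqd).elim
        exact fun hd => not_dvd_card_pPrimeCore
          (hd.trans (Subgroup.card_dvd_of_le inf_le_right))
    | succ n ih =>
      rcases hc.2.2.2 (H ⊓ (Subgroup.upperCentralSeries (G ⧸ pPrimeCore q G) (n + 1)).comap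
        (QuotientGroup.mk' (pPrimeCore q G)) ⊔ K) inferInstance le_sup_right
        (sup_le inf_le_left hc.2.2.1.le) with h1 | h1
      · exact sup_eq_right.mp h1
      · refine (hcen ?_).elim
        rw [← h1]
        refine sup_le (fun x hx y => ih ⟨le_upperCentralSeriesStep H hx.1 y, ?_⟩)
          (le_upperCentralSeriesStep K)
        exact Subgroup.mem_upperCentralSeries_succ_iff.mp hx.2 (y : G ⧸ pPrimeCore q G)
  refine hc.2.2.1.not_ge fun x hx => ?_
  obtain ⟨n, hn⟩ := mem_hypercentre.mp (h ⟨x, hHN hx, rfl⟩)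
  exact key n ⟨hx, hn⟩

/-- Descend along chief factors below `N`, which are of order prime to `p` or central: `UN/L` is
`p`-nilpotent for `L = N`, hence for every term `L` of a chief series below `N`. -/
lemma IsHypercentral.isPNilpotent_sup [Finite G] {U N : Subgroup G} (hN : N.Normal)
    (h : IsHypercentral {p} (fun (X : Type u) [Group X] => Group.IsNilpotent X) N)
    (hU : IsPNilpotent p U) : IsPNilpotent p (U ⊔ N : Subgroup G) := by
  obtain ⟨L, ⟨⟨hL, hLp⟩, hLN⟩, hmin⟩ := (Set.toFinite {L : Subgroup G | (∃ _ : L.Normal,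
      IsPNilpotent p ((U ⊔ N).map (QuotientGroup.mk' L))) ∧ L ≤ N}).exists_minimal
    ⟨N, ⟨hN, by
      rw [Subgroup.map_sup, QuotientGroup.map_mk'_self, sup_bot_eq]
      exact hU.of_surjective ((QuotientGroup.mk' N).subgroupMap_surjective U)⟩, le_rfl⟩
  rcases eq_or_ne L ⊥ with rfl | hne
  · refine hLp.of_map (Or.inl ?_)
    rw [QuotientGroup.ker_mk']
    simpa using hp.out.ne_one
  obtain ⟨K, ⟨hK, hKL⟩, hmax⟩ := (Set.toFinite
    {K : Subgroup G | K.Normal ∧ K < L}).exists_maximal ⟨⊥, inferInstance, hne.bot_lt⟩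
  have hc : IsChiefFactor K L := ⟨hK, hL, hKL, fun M hM hKM hML =>
    hML.eq_or_lt.symm.imp_left fun hlt => le_antisymm (hmax ⟨hM, hlt⟩ hKM) hKM⟩
  refine (hKL.not_ge (hmin ⟨⟨hK, ?_⟩, hKL.le.trans hLN⟩ hKL.le)).elim
  let f : G ⧸ K →* G ⧸ L := QuotientGroup.map K L (MonoidHom.id G) hKL.le
  have hker : f.ker = factor K L := by
    exact QuotientGroup.ker_map K L (MonoidHom.id G) hKL.le
  have himg : ((U ⊔ N).map (QuotientGroup.mk' K)).map f = (U ⊔ N).map (QuotientGroup.mk' L) := by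
    rw [Subgroup.map_map]; rfl
  refine IsPNilpotent.of_map (f := f) (by rwa [himg]) ?_
  rw [hker]
  by_cases hd : p ∣ Nat.card (factor K L)
  · exact Or.inr (factor_le_center_of_isNilpotent hc (h K L hc hLN ⟨p, rfl, hd⟩))
  · exact Or.inl hd

/-! ### The intersection of the maximal `p`-nilpotent subgroups -/

omit hp in
lemma intMaxPNilpotent_le {U : Subgroup G}
    (hU : Maximal (fun V : Subgroup G => IsPNilpotent p V) U) : intMaxPNilpotent p G ≤ U :=
  sInf_le hU

variable [Finite G]

omit hp in
lemma exists_maximal_isPNilpotent {V : Subgroup G} (hV : IsPNilpotent p V) :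
    ∃ U, V ≤ U ∧ Maximal (fun V : Subgroup G => IsPNilpotent p V) U :=
  (Set.toFinite {V : Subgroup G | IsPNilpotent p V}).exists_le_maximal hV

lemma IsHypercentral.le_intMaxPNilpotent {N : Subgroup G} (hN : N.Normal)
    (h : IsHypercentral {p} (fun (X : Type u) [Group X] => Group.IsNilpotent X) N) :
    N ≤ intMaxPNilpotent p G :=
  le_sInf fun _ hU => le_sup_right.trans (hU.2 (h.isPNilpotent_sup hN hU.1) le_sup_left)

omit hp [Finite G] in
lemma isPNilpotent_of_not_dvd_card {V : Subgroup G} (h : ¬ p ∣ Nat.card V) : IsPNilpotent p V :=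
  ⟨⊤, inferInstance, by rwa [Subgroup.card_top], by
    have : Subsingleton (V ⧸ (⊤ : Subgroup V)) := QuotientGroup.subsingleton_quotient_top
    exact IsPGroup.of_subsingleton p _⟩

variable (G p) in
lemma isPNilpotent_intMaxPNilpotent : IsPNilpotent p (intMaxPNilpotent p G) := by
  obtain ⟨U, -, hU⟩ := exists_maximal_isPNilpotent (p := p) (V := (⊥ : Subgroup G))
    (isPNilpotent_of_not_dvd_card (by simpa using hp.out.ne_one))
  exact hU.1.of_le (intMaxPNilpotent_le hU)

instance intMaxPNilpotent_characteristic : (intMaxPNilpotent p G).Characteristic := by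
  refine Subgroup.characteristic_iff_le_comap.mpr fun φ x hx => ?_
  refine (Subgroup.mem_sInf.mpr fun U hU => ?_ : φ x ∈ intMaxPNilpotent p G)
  refine (intMaxPNilpotent_le (U := U.comap φ.toMonoidHom) ⟨?_, fun V hV hle => ?_⟩ hx :)
  · exact hU.1.of_injective (f := φ.toMonoidHom.subgroupComap U) fun a b hab =>
      Subtype.ext (φ.injective (congrArg Subtype.val hab))
  · refine Subgroup.map_le_iff_le_comap.mp (hU.2 (hV.of_surjective
      (φ.toMonoidHom.subgroupMap_surjective V)) ?_)
    rw [← Subgroup.map_comap_eq_self_of_surjective (f := φ.toMonoidHom) φ.surjective U]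
    exact Subgroup.map_mono hle

/-- An element `g` of order prime to `p` lies in a maximal `p`-nilpotent subgroup `U`, and even in
`O_{p'}(U)`. Hence its commutators with elements of `D ≤ U` lie in `D ⊓ O_{p'}(U) ≤ O_{p'}(D)`. -/
lemma commutator_mem_pPrimeCore {g d : G} (hg : ¬ p ∣ orderOf g)
    (hd : d ∈ intMaxPNilpotent p G) : ⁅g, d⁆ ∈ pPrimeCore p G := by
  obtain ⟨U, hgU, hU⟩ := exists_maximal_isPNilpotent (p := p) (V := Subgroup.zpowers g)
    (isPNilpotent_of_not_dvd_card (by rwa [Nat.card_zpowers]))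
  have hgU' : g ∈ U := hgU (Subgroup.mem_zpowers g)
  have hdU : d ∈ U := intMaxPNilpotent_le hU hd
  have hgT : (⟨g, hgU'⟩ : U) ∈ pPrimeCore p U :=
    hU.1.mem_pPrimeCore (by rwa [← Subgroup.orderOf_coe])
  have hcT : ⁅(⟨g, hgU'⟩ : U), (⟨d, hdU⟩ : U)⁆ ∈ pPrimeCore p U :=
    le_upperCentralSeriesStep _ hgT _
  have hcp : ¬ p ∣ orderOf ⁅g, d⁆ := by
    intro hdvd
    have h1 := Subgroup.orderOf_dvd_natCard _ hcT
    rw [← Subgroup.orderOf_coe] at h1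
    exact not_dvd_card_pPrimeCore (hdvd.trans h1)
  have hcD : ⁅g, d⁆ ∈ intMaxPNilpotent p G := by
    rw [commutatorElement_def]
    exact mul_mem (Subgroup.Normal.conj_mem inferInstance d hd g) (inv_mem hd)
  exact map_subtype_pPrimeCore_le (intMaxPNilpotent p G)
    ⟨⟨_, hcD⟩, (isPNilpotent_intMaxPNilpotent G p).mem_pPrimeCore
      (by rwa [← Subgroup.orderOf_coe]), rfl⟩

variable (G p) in
lemma map_intMaxPNilpotent_le_hypercentre :
    (intMaxPNilpotent p G).map (QuotientGroup.mk' (pPrimeCore p G)) ≤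
      hypercentre (G ⧸ pPrimeCore p G) := by
  have hn : ((intMaxPNilpotent p G).map (QuotientGroup.mk' (pPrimeCore p G))).Normal :=
    Subgroup.Normal.map inferInstance _ (QuotientGroup.mk'_surjective _)
  refine le_hypercentre_of_isPGroup (p := p) ?_ fun y => ?_
  · rintro ⟨_, d, hd, rfl⟩
    obtain ⟨k, hk⟩ := isPNilpotent_iff.mp (isPNilpotent_intMaxPNilpotent G p) ⟨d, hd⟩
    refine ⟨k, Subtype.ext ?_⟩
    exact (QuotientGroup.eq_one_iff (d ^ p ^ k)).mpr
      (map_subtype_pPrimeCore_le (intMaxPNilpotent p G) ⟨_, hk, rfl⟩)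
  · obtain ⟨g, rfl⟩ := QuotientGroup.mk_surjective y
    obtain ⟨k, hk⟩ := exists_pow_not_dvd_orderOf (p := p) g
    refine ⟨k, ?_⟩
    rintro _ ⟨d, hd, rfl⟩
    rw [← commutatorElement_eq_one_iff_mul_comm]
    exact (QuotientGroup.eq_one_iff ⁅g ^ p ^ k, d⁆).mpr (commutator_mem_pPrimeCore hk hd)

variable (G p) in
lemma map_subtype_pPrimeCore_intMaxPNilpotent :
    (pPrimeCore p (intMaxPNilpotent p G)).map (intMaxPNilpotent p G).subtype =
      pPrimeCore p G := by
  refine le_antisymm (map_subtype_pPrimeCore_le _) fun x hx => ?_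
  have hxD : x ∈ intMaxPNilpotent p G :=
    (isHypercentral_of_map_le_hypercentre (p := p) (N := pPrimeCore p G)
      (by simp [QuotientGroup.map_mk'_self])).le_intMaxPNilpotent (pPrimeCore_normal p G) hx
  refine ⟨⟨x, hxD⟩, (isPNilpotent_intMaxPNilpotent G p).mem_pPrimeCore ?_, rfl⟩
  rw [← Subgroup.orderOf_coe]
  exact fun hd => not_dvd_card_pPrimeCore (hd.trans (Subgroup.orderOf_dvd_natCard _ hx))

end Central

end PNilp

theorem corollary4p7 (p : ℕ) (hp : p.Prime) (G : Type u) [Group G] [Finite G] :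
    IsGreatest
      {N : Subgroup G | N.Normal ∧
        (PNilp.pPrimeCore p N).map N.subtype = PNilp.pPrimeCore p G ∧
        N.map (QuotientGroup.mk' (PNilp.pPrimeCore p G)) ≤
          PNilp.hypercentre (G ⧸ PNilp.pPrimeCore p G)}
      (PNilp.intMaxPNilpotent p G) ∧
    PNilp.intMaxPNilpotent p G = PNilp.pNilpotentHypercentre p G := by
  have := Fact.mk hp
  have hZ := PNilp.map_intMaxPNilpotent_le_hypercentre G p
  refine ⟨⟨⟨inferInstance, PNilp.map_subtype_pPrimeCore_intMaxPNilpotent G p, hZ⟩, ?_⟩, ?_⟩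
  · rintro N ⟨hN, -, hNZ⟩
    exact (PNilp.isHypercentral_of_map_le_hypercentre hNZ).le_intMaxPNilpotent hN
  · refine le_antisymm
      (le_sSup ⟨inferInstance, PNilp.isHypercentral_of_map_le_hypercentre hZ⟩) ?_
    exact sSup_le fun N hN => PNilp.IsHypercentral.le_intMaxPNilpotent hN.1 hN.2
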